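/- \textbf{Setting.} A public-coin (non-interactive) local protocol for $n$ users with input space $\mathcal X$ consists of a distribution $\mathcal D_{\mathrm{pub}}$ of a public random string $\gamma$, a local randomizer $R$, which on public string $\gamma$ and input $x\in\mathcal X$ sends a random message $R_\gamma(x)$, and a (possibly randomized) analyzer $A$. On a dataset $X=(x_1,\dots,x_n)$, one samples $\gamma\leftarrow\mathcal D_{\mathrm{pub}}$, all users apply the same randomizer independently of each other given $\gamma$, and the output is $P(X)=A(\gamma,R_\gamma(x_1),\dots,R_\gamma(x_n))\in\mathbb R$. For $\epsilon\ge 0$ the protocol is $(\epsilon,\delta)$-locally DP if for all inputs $x,x'$ and all events $S$, $$\Pr[(\gamma,R_\gamma(x))\in S]\le e^{\epsilon}\,\Pr[(\gamma,R_\gamma(x'))\in S]+\delta .$$ $\mathsf{CountDistinct}_{n,n}$ is the function that maps a dataset in $[n]^n$ to the number of its distinct elements. A protocol solves it with error $e$ if on every dataset $X\in[n]^n$, with probability at least $0.99$, $|P(X)-\mathsf{CountDistinct}_{n,n}(X)|\le e$. \textbf{Theorem.} \begin{enumerate} \item For $0\le\epsilon=O(1)$, no public-coin $(\epsilon,o(1/n))$-locally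 DP protocol solves $\mathsf{CountDistinct}_{n,n}$ with error $o(n)$. That is, for all sequences $\epsilon_n\ge 0$ with $\epsilon_n=O(1)$, $\delta_n=o(1/n)$ and $e_n=o(n)$, for all sufficiently large $n$ no public-coin $(\epsilon_n,\delta_n)$-locally DP protocol for $n$ users solves $\mathsf{CountDistinct}_{n,n}$ with error $e_n$. \item More generally, for $0\le\epsilon\le 0.49\ln n$ the error is $\Omega(n/e^{\epsilon})$: there are absolute constants $c>0$ and $N$ such that for all $n\ge N$ and all $0\le\epsilon\le 0.49\ln n$, no public-coin $(\epsilon,c/n)$-locally DP protocol for $n$ users solves $\mathsf{CountDistinct}_{n,n}$ with error $c\,n/e^{\epsilon}$. \item For every $n\ge 2$, the global sensitivity of $\mathsf{CountDistinct}_{n,n}$ (the supremum of its change between two datasets that differ, up to order, in the input of one user) is $1$. So, by 1., the gap between global sensitivity and error in the local model can be linear in $n$. \end{enumerate} -/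

import Mathlib

open Filter MeasureTheory ProbabilityTheory Asymptotics

universe u v

namespace LocalDP

/-- Two datasets of `n` user inputs are neighboring if, up to the order of the entries, they differ
in (at most) the input of a single user. -/
def Neighboring {n : ℕ} {X : Type*} (x x' : Fin n → X) : Prop :=
  ∃ (σ : Equiv.Perm (Fin n)) (i : Fin n), ∀ j, j ≠ i → x' j = x (σ j)

/-- `(ε, δ)`-differential privacy of a randomized function `Q` on datasets of `n` inputs, where
`Q x` is the law of the output on the dataset `x`. -/
def IsDP {n : ℕ} {X Z : Type*} [MeasurableSpace Z] (Q : (Fin n → X) → Measure Z)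
    (ε δ : ℝ) : Prop :=
  ∀ x x' : Fin n → X, Neighboring x x' → ∀ S : Set Z, MeasurableSet S →
    (Q x).real S ≤ Real.exp ε * (Q x').real S + δ

/-- The kernel that, on input `a`, samples the coordinates independently, the `i`-th one from
`κ i a`. -/
noncomputable def piKernel {n : ℕ} {A M : Type*} [MeasurableSpace A] [MeasurableSpace M]
    (κ : Fin n → Kernel A M) [∀ i, IsMarkovKernel (κ i)] : Kernel A (Fin n → M) where
  toFun a := Measure.pi fun i => κ i a
  measurable' := by
    refine Measurable.measure_of_isPiSystem_of_isProbabilityMeasure generateFrom_pi.symm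
      isPiSystem_pi ?_
    rintro _ ⟨t, ht, rfl⟩
    simp only [Measure.pi_pi]
    exact Finset.measurable_prod _ fun i _ =>
      (κ i).measurable_coe (ht i (Set.mem_univ i))

/-- A public-coin (non-interactive) local protocol with `n` users, input space `X`, public coins in
`Γ` and messages in `M`.  A public random string `γ` is drawn from `coin`; every user applies the
same local randomizer, which sends a message with law `randomizer x γ` on input `x`; the analyzer
sees `γ` and all messages and outputs a (possibly randomized) real number. -/
structure Protocol (n : ℕ) (X Γ M : Type*) [MeasurableSpace Γ] [MeasurableSpace M] where
  coin : Measure Γ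
  coin_prob : IsProbabilityMeasure coin
  randomizer : X → Kernel Γ M
  randomizer_markov : ∀ x, IsMarkovKernel (randomizer x)
  analyzer : Kernel (Γ × (Fin n → M)) ℝ
  analyzer_markov : IsMarkovKernel analyzer

attribute [instance] Protocol.coin_prob Protocol.randomizer_markov Protocol.analyzer_markov

namespace Protocol

variable {n : ℕ} {X Γ M : Type*} [MeasurableSpace Γ] [MeasurableSpace M]

/-- The joint law of the public coin and the message of a user with input `x`. -/
noncomputable def view (P : Protocol n X Γ M) (x : X) : Measure (Γ × M) :=
  P.coin ⊗ₘ P.randomizer x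

/-- The protocol is `(ε, δ)`-DP in the public-coin local model: the randomized function
`x ↦ (γ, R_γ(x))` of a single user's input is `(ε, δ)`-DP. -/
def IsLocallyDP (P : Protocol n X Γ M) (ε δ : ℝ) : Prop :=
  IsDP (n := 1) (fun x : Fin 1 → X => P.view (x 0)) ε δ

/-- The joint law of the public coin and all messages, on the dataset `x`: given the coin, the
users' messages are independent. -/
noncomputable def transcript (P : Protocol n X Γ M) (x : Fin n → X) :
    Measure (Γ × (Fin n → M)) :=
  P.coin ⊗ₘ piKernel fun i => P.randomizer (x i)

/-- The law of the output of the protocol on the dataset `x`. -/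
noncomputable def output (P : Protocol n X Γ M) (x : Fin n → X) : Measure ℝ :=
  (P.transcript x).bind P.analyzer

/-- The protocol computes `f` with error `e`: on every dataset, with probability at least `0.99`,
its output is within `e` of the true value. -/
def Solves (P : Protocol n X Γ M) (f : (Fin n → X) → ℝ) (e : ℝ) : Prop :=
  ∀ x : Fin n → X, 0.99 ≤ (P.output x).real {z | |z - f x| ≤ e}

end Protocol

/-- The number of distinct elements among the inputs of `n` users, from a universe of size `D`. -/
def countDistinct (n D : ℕ) (x : Fin n → Fin D) : ℝ :=
  ((Finset.univ.image x).card : ℝ)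

/-- `s` is the global sensitivity of `f`: the least upper bound of the change of `f` between
neighboring datasets. -/
def IsGlobalSensitivity {n : ℕ} {X : Type*} (f : (Fin n → X) → ℝ) (s : ℝ) : Prop :=
  IsLUB {d : ℝ | ∃ x x' : Fin n → X, Neighboring x x' ∧ d = |f x - f x'|} s

end LocalDP

/-!
Let `Q` be the joint law of the coin and one message when the user's input is uniformly random, and
let `r x` be the density with respect to `Q` of the same law for the input `x`. Privacy says that,
outside an event of mass `δ`, `r x` is at most `e ^ ε`, so the truncation `min (r x) (e ^ ε)` has
second moment at most `e ^ ε` under `Q`. Choosing signs greedily, one pair of inputs at a time,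
gives a balanced signing `σ` of the inputs for which the signed sum of the truncated densities has
second moment at most `n * e ^ ε`: the truncated densities behave like orthogonal ones. Now perturb
the uniform distribution to the weights `(1 + τ * σ x) / n`. In the law of a single view this lowers
the Hellinger affinity with `Q` from `1` by at most `τ ^ 2 * e ^ ε / n + 2 * τ * δ`, and, the
messages being independent given the coin, in the law of the whole transcript by at most `n` times
as much. For `τ` of order `e ^ (-ε / 2)` and `δ` of order `1 / n` the two output laws are therefore
close. On the other hand, by convexity of `(1 - p) ^ n`, the perturbation raises the expected number
of inputs that nobody holds by order `n * τ ^ 2 = n / e ^ ε`, which exceeds its standard deviation,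
of order `√n`, as long as `e ^ (2 * ε)` is small compared with `n`. An accurate analyzer would tell
the two cases apart.
-/

namespace LocalDP

section PiMeasure

variable {ι : Type*} {Ω : Type*} [MeasurableSpace Ω] {β : ι → Type*}
  [∀ i, MeasurableSpace (β i)]

theorem ext_prod_univ_pi [Finite ι] {μ ν : Measure (Ω × (∀ i, β i))} [IsFiniteMeasure μ]
    (h : ∀ A, MeasurableSet A → ∀ B : ∀ i, Set (β i), (∀ i, MeasurableSet (B i)) →
      μ (A ×ˢ Set.univ.pi B) = ν (A ×ˢ Set.univ.pi B)) : μ = ν := by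
  refine ext_of_generate_finite _ (generateFrom_eq_prod (C := {A : Set Ω | MeasurableSet A})
    MeasurableSpace.generateFrom_measurableSet
    generateFrom_pi isCountablySpanning_measurableSet
    (.pi fun i => isCountablySpanning_measurableSet)).symm
    (MeasurableSpace.isPiSystem_measurableSet.prod isPiSystem_pi) ?_ ?_
  · rintro _ ⟨A, hA, _, ⟨B, hB, rfl⟩, rfl⟩
    exact h A hA B fun i => hB i (Set.mem_univ i)
  · simpa using h Set.univ .univ (fun _ => Set.univ) fun _ => .univ

variable [Fintype ι]

theorem setLIntegral_univ_pi_prod (ν : ∀ i, Measure (β i)) [∀ i, IsProbabilityMeasure (ν i)]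
    {f : ∀ i, β i → ENNReal} (hf : ∀ i, Measurable (f i)) {B : ∀ i, Set (β i)}
    (hB : ∀ i, MeasurableSet (B i)) :
    ∫⁻ m in Set.univ.pi B, ∏ i, f i (m i) ∂Measure.pi ν = ∏ i, ∫⁻ x in B i, f i x ∂ν i := by
  have hfB : ∀ i, Measurable ((B i).indicator (f i)) := fun i => (hf i).indicator (hB i)
  have hind : ((Set.univ.pi B).indicator fun m => ∏ i, f i (m i)) =
      fun m => ∏ i, (B i).indicator (f i) (m i) := by
    ext m
    by_cases hm : m ∈ Set.univ.pi B
    · rw [Set.indicator_of_mem hm]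
      exact Finset.prod_congr rfl fun i _ => (Set.indicator_of_mem (hm i trivial) _).symm
    · obtain ⟨i, hi⟩ : ∃ i, m i ∉ B i := by simpa using hm
      rw [Set.indicator_of_notMem hm]
      exact (Finset.prod_eq_zero (Finset.mem_univ i) (Set.indicator_of_notMem hi _)).symm
  rw [← lintegral_indicator (MeasurableSet.univ_pi hB), hind,
    lintegral_prod_eq_prod_lintegral_of_indepFun Finset.univ
      (fun i (m : ∀ i, β i) => (B i).indicator (f i) (m i))
      (iIndepFun_pi fun i => (hfB i).aemeasurable)
      fun i => (hfB i).comp (measurable_pi_apply i)]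
  refine Finset.prod_congr rfl fun i _ => ?_
  rw [(measurePreserving_eval ν i).lintegral_comp (hfB i), lintegral_indicator (hB i)]

end PiMeasure

section ConditionallyIndependentMessages

variable {Γ M : Type*} [MeasurableSpace Γ] [MeasurableSpace M] {n : ℕ}

theorem piKernel_apply (κ : Fin n → Kernel Γ M) [∀ i, IsMarkovKernel (κ i)] (γ : Γ) :
    piKernel κ γ = Measure.pi fun i => κ i γ := rfl

instance (κ : Fin n → Kernel Γ M) [∀ i, IsMarkovKernel (κ i)] : IsMarkovKernel (piKernel κ) :=
  ⟨fun γ => by rw [piKernel_apply]; infer_instance⟩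

theorem ae_apply_eq_setLIntegral_of_compProd_eq_withDensity {ρ : Measure Γ} [SigmaFinite ρ]
    {κ η : Kernel Γ M} [IsSFiniteKernel κ] [IsSFiniteKernel η] {r : Γ × M → ENNReal}
    (hr : Measurable r) (h : ρ ⊗ₘ κ = (ρ ⊗ₘ η).withDensity r) {B : Set M} (hB : MeasurableSet B) :
    (fun γ => κ γ B) =ᵐ[ρ] fun γ => ∫⁻ m in B, r (γ, m) ∂η γ := by
  refine ae_eq_of_forall_setLIntegral_eq_of_sigmaFinite (κ.measurable_coe hB)
    (Measurable.setLIntegral_kernel_prod_right (f := fun γ m => r (γ, m)) hr hB)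
    fun A hA _ => ?_
  rw [← Measure.compProd_apply_prod hA hB, h, withDensity_apply _ (hA.prod hB),
    Measure.setLIntegral_compProd hr hA hB]

theorem compProd_piKernel_eq_withDensity {ρ : Measure Γ} [IsProbabilityMeasure ρ]
    {κ : Fin n → Kernel Γ M} [∀ i, IsMarkovKernel (κ i)] {η : Kernel Γ M} [IsMarkovKernel η]
    {r : Fin n → Γ × M → ENNReal} (hr : ∀ i, Measurable (r i))
    (h : ∀ i, ρ ⊗ₘ κ i = (ρ ⊗ₘ η).withDensity (r i)) :
    ρ ⊗ₘ piKernel κ =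
      (ρ ⊗ₘ piKernel fun _ : Fin n => η).withDensity fun t => ∏ i, r i (t.1, t.2 i) := by
  have hprod : Measurable fun t : Γ × (Fin n → M) => ∏ i, r i (t.1, t.2 i) :=
    Finset.measurable_prod _ fun i _ => (hr i).comp (by fun_prop)
  refine ext_prod_univ_pi fun A hA B hB => ?_
  have hBm : MeasurableSet (Set.univ.pi B) := .univ_pi hB
  rw [Measure.compProd_apply_prod hA hBm, withDensity_apply _ (hA.prod hBm),
    Measure.setLIntegral_compProd hprod hA hBm]
  refine lintegral_congr_ae (ae_restrict_of_ae ?_)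
  filter_upwards [ae_all_iff.2 fun i =>
    ae_apply_eq_setLIntegral_of_compProd_eq_withDensity (hr i) (h i) (hB i)] with γ hγ
  simp only [piKernel_apply, Measure.pi_pi, hγ]
  exact (setLIntegral_univ_pi_prod (fun _ => η γ)
    (fun i => (hr i).comp measurable_prodMk_left) hB).symm

end ConditionallyIndependentMessages

section Affinity

variable {Ω : Type*} [MeasurableSpace Ω] {μ : Measure Ω}

theorem memLp_sqrt {F : Ω → ℝ} (h0 : 0 ≤ F) (hF : Integrable F μ) :
    MemLp (fun ω => √(F ω)) 2 μ :=
  (memLp_two_iff_integrable_sq (Real.continuous_sqrt.comp_aestronglyMeasurable hF.1)).2 <| by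
    simpa only [Real.sq_sqrt (h0 _)] using hF

theorem sq_integral_mul_le {f g : Ω → ℝ} (hf0 : ∀ ω, 0 ≤ f ω) (hg0 : ∀ ω, 0 ≤ g ω)
    (hf : MemLp f 2 μ) (hg : MemLp g 2 μ) :
    (∫ ω, f ω * g ω ∂μ) ^ 2 ≤ (∫ ω, f ω ^ 2 ∂μ) * ∫ ω, g ω ^ 2 ∂μ := by
  have h := integral_mul_le_Lp_mul_Lq_of_nonneg Real.HolderConjugate.two_two
    (ae_of_all μ hf0) (ae_of_all μ hg0) (by simpa using hf) (by simpa using hg)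
  simp only [Real.rpow_two, ← Real.sqrt_eq_rpow] at h
  rw [← Real.sqrt_mul (integral_nonneg fun ω => sq_nonneg _)] at h
  exact (Real.le_sqrt (integral_nonneg fun ω => mul_nonneg (hf0 ω) (hg0 ω))
    (by positivity)).1 h

-- Cauchy–Schwarz for `|F - 1| = |√F - 1| * (√F + 1)`.
theorem sq_integral_abs_sub_one_le [IsProbabilityMeasure μ] {F : Ω → ℝ} (h0 : 0 ≤ F)
    (hF : Integrable F μ) (h1 : ∫ ω, F ω ∂μ = 1) :
    (∫ ω, |F ω - 1| ∂μ) ^ 2 ≤ 8 * (1 - ∫ ω, √(F ω) ∂μ) := by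
  have hs : MemLp (fun ω => √(F ω)) 2 μ := memLp_sqrt h0 hF
  have hsi : Integrable (fun ω => √(F ω)) μ := hs.integrable one_le_two
  have hsub : MemLp (fun ω => |√(F ω) - 1|) 2 μ := (hs.sub (memLp_const 1)).abs
  have hadd : MemLp (fun ω => √(F ω) + 1) 2 μ := hs.add (memLp_const 1)
  have hfactor : ∀ ω, |F ω - 1| = |√(F ω) - 1| * (√(F ω) + 1) := fun ω => by
    rw [← abs_of_nonneg (by positivity : 0 ≤ √(F ω) + 1), ← abs_mul]
    congr 1
    linear_combination -Real.sq_sqrt (h0 ω)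
  have hsq : ∀ c : ℝ, c ^ 2 = 1 →
      ∫ ω, (√(F ω) + c) ^ 2 ∂μ = 2 + 2 * c * ∫ ω, √(F ω) ∂μ := fun c hc => by
    have : ∀ ω, (√(F ω) + c) ^ 2 = F ω + 2 * c * √(F ω) + 1 := fun ω => by
      linear_combination Real.sq_sqrt (h0 ω) + hc
    simp only [this]
    rw [integral_add (by fun_prop) (by fun_prop), integral_add (by fun_prop) (by fun_prop),
      integral_const_mul, h1]
    simp
    ring
  have hbound := sq_integral_mul_le (fun ω => abs_nonneg (√(F ω) - 1))
    (fun ω => by positivity) hsub hadd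
  simp only [← hfactor, sq_abs] at hbound
  have hminus := hsq (-1) (by norm_num)
  simp only [← sub_eq_add_neg] at hminus
  rw [hminus, hsq 1 (by norm_num)] at hbound
  have hnonneg : 0 ≤ ∫ ω, (√(F ω) - 1) ^ 2 ∂μ := integral_nonneg fun ω => sq_nonneg _
  nlinarith

end Affinity

section TensorizedAffinity

variable {Γ M : Type*} [MeasurableSpace Γ] [MeasurableSpace M] {n : ℕ}
  {ρ : Measure Γ} [IsProbabilityMeasure ρ] {η : Kernel Γ M} [IsMarkovKernel η]

theorem integrable_integral_of_compProd {f : Γ × M → ℝ} (hf : Integrable f (ρ ⊗ₘ η)) :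
    Integrable (fun γ => ∫ m, f (γ, m) ∂η γ) ρ :=
  Integrable.integral_compProd (κ := Kernel.const Unit ρ) (η := Kernel.prodMkLeft Unit η)
    (a := ()) hf

-- Bernoulli's inequality, applied to the conditional means given the coin.
theorem one_add_mul_le_integral_prod {g : Γ × M → ℝ} (h0 : 0 ≤ g) (hg : Integrable g (ρ ⊗ₘ η))
    (hprod : Integrable (fun t => ∏ i, g (t.1, t.2 i)) (ρ ⊗ₘ piKernel fun _ : Fin n => η)) :
    1 + n * (∫ ω, g ω ∂(ρ ⊗ₘ η) - 1) ≤
      ∫ t, ∏ i, g (t.1, t.2 i) ∂(ρ ⊗ₘ piKernel fun _ : Fin n => η) := by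
  have hmean := integrable_integral_of_compProd hg
  have hpow : ∀ γ, ∫ m, ∏ i, g (γ, m i) ∂(piKernel (fun _ : Fin n => η) γ) =
      (∫ m, g (γ, m) ∂η γ) ^ n := fun γ => by
    rw [piKernel_apply, integral_fintype_prod_eq_pow fun m => g (γ, m), Fintype.card_fin]
  have hpowi := integrable_integral_of_compProd hprod
  rw [Measure.integral_compProd hg, Measure.integral_compProd hprod]
  simp only [hpow] at hpowi ⊢
  calc 1 + n * (∫ γ, ∫ m, g (γ, m) ∂η γ ∂ρ - 1)
      = ∫ γ, (1 + n * (∫ m, g (γ, m) ∂η γ - 1)) ∂ρ := by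
        rw [integral_add (by fun_prop) (by fun_prop), integral_const_mul,
          integral_sub hmean (by fun_prop)]
        simp
    _ ≤ ∫ γ, (∫ m, g (γ, m) ∂η γ) ^ n ∂ρ := by
        refine integral_mono (by fun_prop) hpowi fun γ => ?_
        have hmean0 : 0 ≤ ∫ m, g (γ, m) ∂η γ := integral_nonneg fun m => h0 _
        simpa using one_add_mul_le_pow (a := ∫ m, g (γ, m) ∂η γ - 1) (by linarith) n

theorem sq_integral_abs_prod_sub_one_le {f : Γ × M → ℝ} (h0 : 0 ≤ f) (hf : Integrable f (ρ ⊗ₘ η))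
    (h1 : ∫ t, ∏ i, f (t.1, t.2 i) ∂(ρ ⊗ₘ piKernel fun _ : Fin n => η) = 1) :
    (∫ t, |∏ i, f (t.1, t.2 i) - 1| ∂(ρ ⊗ₘ piKernel fun _ : Fin n => η)) ^ 2 ≤
      8 * n * (1 - ∫ ω, √(f ω) ∂(ρ ⊗ₘ η)) := by
  have hprod := integrable_of_integral_eq_one h1
  have hprod0 : 0 ≤ fun t : Γ × (Fin n → M) => ∏ i, f (t.1, t.2 i) :=
    fun t => Finset.prod_nonneg fun i _ => h0 _
  have hsqrt : ∀ t : Γ × (Fin n → M), √(∏ i, f (t.1, t.2 i)) = ∏ i, √(f (t.1, t.2 i)) :=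
    fun t => Real.sqrt_prod _ fun i _ => h0 _
  have hprodi := (memLp_sqrt hprod0 hprod).integrable one_le_two
  have hle := sq_integral_abs_sub_one_le hprod0 hprod h1
  simp only [hsqrt] at hle hprodi
  have hB := one_add_mul_le_integral_prod (fun ω => Real.sqrt_nonneg (f ω))
    ((memLp_sqrt h0 hf).integrable one_le_two) hprodi
  linarith

end TensorizedAffinity

section BalancedSigning

variable {Ω : Type*} [MeasurableSpace Ω] {μ : Measure Ω}

theorem exists_abs_eq_one_integral_add_mul_sq_le {f g : Ω → ℝ} (hf : MemLp f 2 μ)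
    (hg : MemLp g 2 μ) :
    ∃ e : ℝ, |e| = 1 ∧
      ∫ ω, (f ω + e * g ω) ^ 2 ∂μ ≤ ∫ ω, f ω ^ 2 ∂μ + ∫ ω, g ω ^ 2 ∂μ := by
  obtain ⟨e, he, hcross⟩ : ∃ e : ℝ, |e| = 1 ∧ e * ∫ ω, f ω * g ω ∂μ ≤ 0 := by
    rcases le_total (∫ ω, f ω * g ω ∂μ) 0 with h | h
    · exact ⟨1, by simp, by linarith⟩
    · exact ⟨-1, by simp, by linarith⟩
  have hf2 := hf.integrable_sq
  have hg2 := hg.integrable_sq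
  have hfg : Integrable (fun ω => f ω * g ω) μ := hf.integrable_mul hg
  have he2 : e ^ 2 = 1 := by rw [← sq_abs, he, one_pow]
  have hexpand : ∀ ω, (f ω + e * g ω) ^ 2 = f ω ^ 2 + g ω ^ 2 + 2 * e * (f ω * g ω) :=
    fun ω => by linear_combination g ω ^ 2 * he2
  refine ⟨e, he, ?_⟩
  simp only [hexpand]
  rw [integral_add (by fun_prop) (by fun_prop), integral_add (by fun_prop) (by fun_prop),
    integral_const_mul]
  linarith

theorem exists_signs_integral_sq_sum_le {ι : Type*} (s : Finset ι) {v : ι → Ω → ℝ}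
    (hv : ∀ i, MemLp (v i) 2 μ) :
    ∃ e : ι → ℝ, (∀ i, |e i| = 1) ∧
      ∫ ω, (∑ i ∈ s, e i * v i ω) ^ 2 ∂μ ≤ ∑ i ∈ s, ∫ ω, v i ω ^ 2 ∂μ := by
  classical
  induction s using Finset.induction_on with
  | empty => exact ⟨1, by simp, by simp⟩
  | insert a s ha ih =>
    obtain ⟨e, he, hle⟩ := ih
    obtain ⟨c, hc, hcle⟩ := exists_abs_eq_one_integral_add_mul_sq_le
      (memLp_finsetSum s fun i _ => (hv i).const_mul (e i)) (hv a)
    refine ⟨Function.update e a c, fun i => ?_, ?_⟩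
    · obtain rfl | hi := eq_or_ne i a
      · rwa [Function.update_self]
      · rw [Function.update_of_ne hi, he]
    · have hsum : ∀ ω, ∑ i ∈ insert a s, Function.update e a c i * v i ω =
          ∑ i ∈ s, e i * v i ω + c * v a ω := fun ω => by
        rw [Finset.sum_insert ha, Function.update_self, add_comm]
        congr 1
        exact Finset.sum_congr rfl fun i hi => by
          rw [Function.update_of_ne (ne_of_mem_of_not_mem hi ha)]
      simp only [hsum]
      rw [Finset.sum_insert ha]
      linarith

/-- A balanced signing of a finite type: signs `±1` of sum zero, where one element may be left with
sign `0` because the cardinality may be odd. Only the bounds on the moments are recorded, so that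
intermediate values are allowed too. -/
structure IsBalancedSigning {X : Type*} [Fintype X] (σ : X → ℝ) : Prop where
  abs_le_one : ∀ x, |σ x| ≤ 1
  sum_eq_zero : ∑ x, σ x = 0
  card_sub_one_le_sum_sq : (Fintype.card X : ℝ) - 1 ≤ ∑ x, σ x ^ 2

theorem integral_sub_sq_le {f g : Ω → ℝ} (hf : MemLp f 2 μ) (hg : MemLp g 2 μ) (hf0 : 0 ≤ f)
    (hg0 : 0 ≤ g) :
    ∫ ω, (f ω - g ω) ^ 2 ∂μ ≤ ∫ ω, f ω ^ 2 ∂μ + ∫ ω, g ω ^ 2 ∂μ := by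
  rw [← integral_add hf.integrable_sq hg.integrable_sq]
  refine integral_mono (hf.sub hg).integrable_sq (hf.integrable_sq.add hg.integrable_sq) fun ω => ?_
  have := mul_nonneg (hf0 ω) (hg0 ω)
  simp only
  linarith

theorem sum_extend_zero_mul {ι X : Type*} [Fintype ι] [Fintype X] {f : ι → X}
    (hf : f.Injective) (s : ι → ℝ) (a : X → ℝ) :
    ∑ x, f.extend s 0 x * a x = ∑ i, s i * a (f i) :=
  (Fintype.sum_of_injective f hf _ _
    (fun x hx => by rw [Function.extend_apply' _ _ _ hx]; simp)
    fun i => by rw [hf.extend_apply]).symm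

theorem isBalancedSigning_extend {ι X : Type*} [Fintype ι] [Fintype X] {f : ι × Bool → X}
    (hf : f.Injective) (hcard : Fintype.card X ≤ 2 * Fintype.card ι + 1) {e : ι → ℝ}
    (he : ∀ i, |e i| = 1) :
    IsBalancedSigning (f.extend (fun q => bif q.2 then e q.1 else -e q.1) 0) where
  abs_le_one x := by
    by_cases hx : x ∈ Set.range f
    · obtain ⟨⟨i, b⟩, rfl⟩ := hx
      rw [hf.extend_apply]
      cases b <;> simp [he]
    · simp [Function.extend_apply' _ _ _ hx]
  sum_eq_zero := by
    simpa [Fintype.sum_prod_type] using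
      sum_extend_zero_mul hf (fun q => bif q.2 then e q.1 else -e q.1) 1
  card_sub_one_le_sum_sq := by
    have hcard' : (Fintype.card X : ℝ) ≤ 2 * Fintype.card ι + 1 := by exact_mod_cast hcard
    have he' : ∀ i, e i * e i = 1 := fun i => by rw [← abs_mul_abs_self, he, one_mul]
    simp only [sq]
    rw [sum_extend_zero_mul hf]
    simp only [hf.extend_apply, Fintype.sum_prod_type, Fintype.sum_bool, cond_true, cond_false,
      neg_mul_neg, he', Finset.sum_const, Finset.card_univ, nsmul_eq_mul]
    linarith

theorem exists_isBalancedSigning_integral_sq_sum_le {X : Type*} [Fintype X] {h : X → Ω → ℝ}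
    (hh : ∀ x, MemLp (h x) 2 μ) (h0 : ∀ x, 0 ≤ h x) :
    ∃ σ : X → ℝ, IsBalancedSigning σ ∧
      ∫ ω, (∑ x, σ x * h x ω) ^ 2 ∂μ ≤ ∑ x, ∫ ω, h x ω ^ 2 ∂μ := by
  obtain ⟨f, hf⟩ : ∃ f : Fin (Fintype.card X / 2) × Bool → X, f.Injective :=
    ⟨_, (Function.Embedding.nonempty_of_card_le (by
      rw [Fintype.card_prod, Fintype.card_fin, Fintype.card_bool]; omega)).some.injective⟩
  obtain ⟨e, he, hle⟩ := exists_signs_integral_sq_sum_le Finset.univ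
    fun j => (hh (f (j, true))).sub (hh (f (j, false)))
  refine ⟨_, isBalancedSigning_extend hf (by rw [Fintype.card_fin]; omega) he, ?_⟩
  have hpairs : ∀ ω, ∑ x, f.extend (fun q => bif q.2 then e q.1 else -e q.1) 0 x * h x ω =
      ∑ j, e j * (h (f (j, true)) - h (f (j, false))) ω := fun ω => by
    rw [sum_extend_zero_mul hf, Fintype.sum_prod_type]
    exact Finset.sum_congr rfl fun j _ => by
      simp only [Fintype.sum_bool, cond_true, cond_false, Pi.sub_apply]; ring
  calc _ = ∫ ω, (∑ j, e j * (h (f (j, true)) - h (f (j, false))) ω) ^ 2 ∂μ := by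
        simp only [hpairs]
    _ ≤ ∑ j, (∫ ω, h (f (j, true)) ω ^ 2 ∂μ + ∫ ω, h (f (j, false)) ω ^ 2 ∂μ) :=
        hle.trans (Finset.sum_le_sum fun j _ => integral_sub_sq_le (hh _) (hh _) (h0 _) (h0 _))
    _ = ∑ x ∈ Finset.univ.map ⟨f, hf⟩, ∫ ω, h x ω ^ 2 ∂μ := by
        simp [Fintype.sum_prod_type]
    _ ≤ ∑ x, ∫ ω, h x ω ^ 2 ∂μ :=
        Finset.sum_le_univ_sum_of_nonneg fun x => integral_nonneg fun ω => sq_nonneg _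

end BalancedSigning

section UniformMixture

variable {X Ω : Type*} [Fintype X] [MeasurableSpace Ω]

/-- The equal-weight mixture of a finite family of measures: the law of a sample from `V x` for
uniformly random `x`. -/
noncomputable def uniformMixture (V : X → Measure Ω) : Measure Ω :=
  (Fintype.card X : ENNReal)⁻¹ • ∑ x, V x

theorem uniformMixture_apply (V : X → Measure Ω) (s : Set Ω) :
    uniformMixture V s = (Fintype.card X : ENNReal)⁻¹ * ∑ x, V x s := by
  rw [uniformMixture, Measure.smul_apply, Measure.finsetSum_apply, smul_eq_mul]

/-- Densities `r x` of the measures `V x` with respect to their uniform mixture. Their sum is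
required to be the number of measures everywhere, not only almost everywhere. -/
structure IsMixtureDensity (V : X → Measure Ω) (r : X → Ω → ℝ) : Prop where
  measurable : ∀ x, Measurable (r x)
  nonneg : ∀ x, 0 ≤ r x
  sum_eq : ∀ ω, ∑ x, r x ω = Fintype.card X
  eq_withDensity : ∀ x, V x = (uniformMixture V).withDensity fun ω => ENNReal.ofReal (r x ω)

variable [Nonempty X]

theorem card_smul_uniformMixture (V : X → Measure Ω) :
    (Fintype.card X : ENNReal) • uniformMixture V = ∑ x, V x := by
  rw [uniformMixture, smul_smul, ENNReal.mul_inv_cancel (by simp) (by simp), one_smul]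

theorem card_mul_uniformMixture_apply (V : X → Measure Ω) (s : Set Ω) :
    Fintype.card X * uniformMixture V s = ∑ x, V x s := by
  rw [← smul_eq_mul, ← Measure.smul_apply, card_smul_uniformMixture, Measure.finsetSum_apply]

instance {V : X → Measure Ω} [∀ x, IsProbabilityMeasure (V x)] :
    IsProbabilityMeasure (uniformMixture V) :=
  ⟨by simpa [uniformMixture_apply] using ENNReal.inv_mul_cancel (by simp) (by simp)⟩

theorem card_mul_real_uniformMixture (V : X → Measure Ω) [∀ x, IsProbabilityMeasure (V x)]
    (s : Set Ω) :
    Fintype.card X * (uniformMixture V).real s = ∑ x, (V x).real s := by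
  simp only [measureReal_def]
  rw [← ENNReal.toReal_sum fun x _ => measure_ne_top _ _, ← card_mul_uniformMixture_apply,
    ENNReal.toReal_mul, ENNReal.toReal_natCast]

theorem absolutelyContinuous_uniformMixture (V : X → Measure Ω) (x : X) :
    V x ≪ uniformMixture V := fun s hs => by
  have hsum := card_mul_uniformMixture_apply V s
  rw [hs, mul_zero, eq_comm, Finset.sum_eq_zero_iff] at hsum
  exact hsum x (Finset.mem_univ x)

theorem ae_sum_rnDeriv_uniformMixture (V : X → Measure Ω) [∀ x, IsProbabilityMeasure (V x)] :
    ∀ᵐ ω ∂uniformMixture V, ∑ x, (V x).rnDeriv (uniformMixture V) ω = Fintype.card X := by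
  have hmeas : ∀ x, Measurable ((V x).rnDeriv (uniformMixture V)) :=
    fun x => Measure.measurable_rnDeriv _ _
  refine (withDensity_eq_iff_of_sigmaFinite (Finset.measurable_fun_sum _ fun x _ =>
    hmeas x).aemeasurable aemeasurable_const).1 ?_
  rw [withDensity_const, card_smul_uniformMixture]
  ext s hs
  rw [withDensity_apply _ hs, lintegral_finsetSum _ fun x _ => hmeas x, Measure.finsetSum_apply]
  exact Finset.sum_congr rfl fun x _ =>
    Measure.setLIntegral_rnDeriv (absolutelyContinuous_uniformMixture V x) s

theorem exists_isMixtureDensity (V : X → Measure Ω) [∀ x, IsProbabilityMeasure (V x)] :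
    ∃ r, IsMixtureDensity V r := by
  classical
  set r₀ : X → Ω → ENNReal := fun x => (V x).rnDeriv (uniformMixture V)
  have hmeas : ∀ x, Measurable (r₀ x) := fun x => Measure.measurable_rnDeriv _ _
  let S : Set Ω := {ω | ∑ x, r₀ x ω = Fintype.card X}
  have hS : MeasurableSet S :=
    measurableSet_eq_fun (Finset.measurable_fun_sum _ fun x _ => hmeas x) measurable_const
  have hfin : ∀ ω ∈ S, ∀ x, r₀ x ω ≠ ⊤ := fun ω hω x =>
    ENNReal.sum_ne_top.1 (hω.trans_ne (ENNReal.natCast_ne_top _)) x (Finset.mem_univ x)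
  refine ⟨fun x => S.piecewise (fun ω => (r₀ x ω).toReal) 1,
    fun x => (hmeas x).ennreal_toReal.piecewise hS measurable_const, fun x ω => ?_, fun ω => ?_,
    fun x => ?_⟩
  · by_cases hω : ω ∈ S <;> simp [hω]
  · by_cases hω : ω ∈ S
    · simp only [Set.piecewise_eq_of_mem _ _ _ hω]
      rw [← ENNReal.toReal_sum fun x _ => hfin ω hω x, hω, ENNReal.toReal_natCast]
    · simp [hω]
  · rw [← Measure.withDensity_rnDeriv_eq _ _ (absolutelyContinuous_uniformMixture V x)]
    refine withDensity_congr_ae ?_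
    filter_upwards [ae_sum_rnDeriv_uniformMixture V] with ω hω
    rw [Set.piecewise_eq_of_mem S _ _ hω, ENNReal.ofReal_toReal (hfin ω hω x)]

end UniformMixture

namespace IsMixtureDensity

variable {X Ω : Type*} [Fintype X] [MeasurableSpace Ω] {V : X → Measure Ω} {r : X → Ω → ℝ}

theorem le_card (hr : IsMixtureDensity V r) (x : X) (ω : Ω) : r x ω ≤ Fintype.card X :=
  (Finset.single_le_sum (f := fun y => r y ω) (fun y _ => hr.nonneg y ω)
    (Finset.mem_univ x)).trans_eq (hr.sum_eq ω)

theorem real_eq_setIntegral (hr : IsMixtureDensity V r) (x : X) {s : Set Ω}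
    (hs : MeasurableSet s) : (V x).real s = ∫ ω in s, r x ω ∂uniformMixture V := by
  rw [integral_eq_lintegral_of_nonneg_ae (ae_of_all _ (hr.nonneg x))
    (hr.measurable x).aestronglyMeasurable, ← withDensity_apply _ hs, ← hr.eq_withDensity x,
    measureReal_def]

theorem integral_eq_one [∀ x, IsProbabilityMeasure (V x)] (hr : IsMixtureDensity V r) (x : X) :
    ∫ ω, r x ω ∂uniformMixture V = 1 := by
  rw [← setIntegral_univ, ← hr.real_eq_setIntegral x .univ, probReal_univ]

variable [Nonempty X] [∀ x, IsProbabilityMeasure (V x)]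

theorem memLp (hr : IsMixtureDensity V r) {p : ENNReal} (x : X) :
    MemLp (r x) p (uniformMixture V) :=
  .of_bound (hr.measurable x).aestronglyMeasurable (Fintype.card X) <| ae_of_all _ fun ω => by
    rw [Real.norm_of_nonneg (hr.nonneg x ω)]
    exact hr.le_card x ω

theorem integrable (hr : IsMixtureDensity V r) (x : X) : Integrable (r x) (uniformMixture V) :=
  memLp_one_iff_integrable.1 (hr.memLp x)

theorem integral_sub_min_le (hr : IsMixtureDensity V r) {E δ : ℝ} {x : X}
    (hx : ∀ y s, MeasurableSet s → (V x).real s ≤ E * (V y).real s + δ) :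
    ∫ ω, (r x ω - min (r x ω) E) ∂uniformMixture V ≤ δ := by
  let S : Set Ω := {ω | E < r x ω}
  have hS : MeasurableSet S := measurableSet_lt measurable_const (hr.measurable x)
  have hexcess : (fun ω => r x ω - min (r x ω) E) = S.indicator fun ω => r x ω - E := by
    ext ω
    by_cases hω : E < r x ω
    · rw [Set.indicator_of_mem (s := S) hω, min_eq_right hω.le]
    · rw [Set.indicator_of_notMem (s := S) hω, min_eq_left (not_lt.1 hω), sub_self]
  have hmean : (V x).real S ≤ E * (uniformMixture V).real S + δ := by
    have hcard : (0 : ℝ) < Fintype.card X := by exact_mod_cast Fintype.card_pos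
    have hsum := Finset.sum_le_sum fun y (_ : y ∈ Finset.univ) => hx y S hS
    rw [Finset.sum_add_distrib, ← Finset.mul_sum, ← card_mul_real_uniformMixture V] at hsum
    simp only [Finset.sum_const, Finset.card_univ, nsmul_eq_mul] at hsum
    exact le_of_mul_le_mul_left (by linarith) hcard
  rw [hexcess, integral_indicator hS,
    integral_sub (hr.integrable x).integrableOn (integrable_const _), setIntegral_const,
    smul_eq_mul, ← hr.real_eq_setIntegral x hS]
  linarith

end IsMixtureDensity

section PerturbedUniform

theorem one_add_half_sub_le_sqrt {u v : ℝ} (h : 0 ≤ 1 + u + v) :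
    1 + (u + v) / 2 - u ^ 2 - 2 * |v| ≤ √(1 + u + v) := by
  rcases le_or_gt |v| 1 with hv | hv
  · set s := √(1 + u + v)
    have hs2 : s ^ 2 = 1 + u + v := Real.sq_sqrt h
    have hpoly : 0 ≤ (s - 1) ^ 2 * (s * (s + 2)) := by positivity
    have hv2 : v ^ 2 ≤ |v| := by
      rw [← sq_abs]
      nlinarith [abs_nonneg v]
    have huv : (s ^ 2 - 1) ^ 2 ≤ 2 * u ^ 2 + 2 * v ^ 2 := by
      rw [hs2]
      nlinarith [sq_nonneg (u - v)]
    linarith [abs_nonneg v]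
  · nlinarith [Real.sqrt_nonneg (1 + u + v), sq_nonneg (u - 1 / 4), le_abs_self v]

theorem one_sub_le_integral_sqrt_one_add_mul {Ω : Type*} [MeasurableSpace Ω] {μ : Measure Ω}
    [IsProbabilityMeasure μ] {u v : Ω → ℝ} (hu : MemLp u 2 μ) (hv : Integrable v μ) {c : ℝ}
    (hc : 0 ≤ c) (h0 : ∀ ω, 0 ≤ 1 + c * (u ω + v ω)) (huv : ∫ ω, (u ω + v ω) ∂μ = 0) :
    1 - c ^ 2 * ∫ ω, u ω ^ 2 ∂μ - 2 * c * ∫ ω, |v ω| ∂μ ≤ ∫ ω, √(1 + c * (u ω + v ω)) ∂μ := by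
  have hu2 : Integrable (fun ω => u ω ^ 2) μ := hu.integrable_sq
  have : Integrable (fun ω => |v ω|) μ := hv.abs
  have hsum : Integrable (fun ω => u ω + v ω) μ := (hu.integrable one_le_two).add hv
  have hsqrt : Integrable (fun ω => √(1 + c * (u ω + v ω))) μ :=
    (memLp_sqrt h0 (by fun_prop)).integrable one_le_two
  have hpoint : ∀ ω, 1 + c / 2 * (u ω + v ω) - c ^ 2 * u ω ^ 2 - 2 * c * |v ω| ≤
      √(1 + c * (u ω + v ω)) := fun ω => by
    have hassoc : 1 + c * (u ω + v ω) = 1 + c * u ω + c * v ω := by ring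
    have h := h0 ω
    rw [hassoc] at h ⊢
    have hle := one_add_half_sub_le_sqrt h
    rw [abs_mul, abs_of_nonneg hc, mul_pow] at hle
    linarith
  have hle := integral_mono (by fun_prop) hsqrt hpoint
  rw [integral_sub (by fun_prop) (by fun_prop), integral_sub (by fun_prop) (by fun_prop),
    integral_add (by fun_prop) (by fun_prop), integral_const_mul, integral_const_mul,
    integral_const_mul, huv] at hle
  simpa using hle

variable {X Ω : Type*} [Fintype X] [MeasurableSpace Ω]

/-- The weights on `X` obtained from the uniform distribution by changing the weight of `x` by the
relative amount `τ * σ x`. -/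
noncomputable def perturbedUniform (τ : ℝ) (σ : X → ℝ) (x : X) : ℝ :=
  (1 + τ * σ x) / Fintype.card X

theorem IsBalancedSigning.perturbedUniform_mem_stdSimplex [Nonempty X] {σ : X → ℝ}
    (hσ : IsBalancedSigning σ) {τ : ℝ} (h0 : 0 ≤ τ) (h1 : τ ≤ 1) :
    perturbedUniform τ σ ∈ stdSimplex ℝ X := by
  refine ⟨fun x => div_nonneg ?_ (Nat.cast_nonneg _), ?_⟩
  · nlinarith [neg_le_of_abs_le (hσ.abs_le_one x)]
  · simp only [perturbedUniform, ← Finset.sum_div, Finset.sum_add_distrib, ← Finset.mul_sum,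
      hσ.sum_eq_zero]
    simp

namespace IsMixtureDensity

variable {V : X → Measure Ω} {r : X → Ω → ℝ}

theorem sum_perturbedUniform_mul [Nonempty X] (hr : IsMixtureDensity V r) (τ : ℝ) (σ : X → ℝ)
    (ω : Ω) :
    ∑ x, perturbedUniform τ σ x * r x ω = 1 + τ / Fintype.card X * ∑ x, σ x * r x ω := by
  calc ∑ x, perturbedUniform τ σ x * r x ω
      = (∑ x, r x ω) / Fintype.card X + τ / Fintype.card X * ∑ x, σ x * r x ω := by
        rw [Finset.sum_div, Finset.mul_sum, ← Finset.sum_add_distrib]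
        exact Finset.sum_congr rfl fun x _ => by rw [perturbedUniform]; ring
    _ = _ := by rw [hr.sum_eq, div_self (by simp)]

variable [Nonempty X] [∀ x, IsProbabilityMeasure (V x)]

theorem memLp_min (hr : IsMixtureDensity V r) (x : X) (E : ℝ) :
    MemLp (fun ω => min (r x ω) E) 2 (uniformMixture V) :=
  (hr.memLp x).inf (memLp_const E)

theorem integral_min_sq_le (hr : IsMixtureDensity V r) (x : X) {E : ℝ} (hE : 0 ≤ E) :
    ∫ ω, min (r x ω) E ^ 2 ∂uniformMixture V ≤ E := by
  calc ∫ ω, min (r x ω) E ^ 2 ∂uniformMixture V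
      ≤ ∫ ω, E * r x ω ∂uniformMixture V := by
        refine integral_mono (hr.memLp_min x E).integrable_sq ((hr.integrable x).const_mul E)
          fun ω => ?_
        simp only
        rw [sq]
        exact mul_le_mul (min_le_right _ _) (min_le_left _ _) (le_min (hr.nonneg x ω) hE) hE
    _ = E := by rw [integral_const_mul, hr.integral_eq_one, mul_one]

theorem integral_abs_sum_mul_sub_min_le (hr : IsMixtureDensity V r) {E δ : ℝ}
    (hV : ∀ x y s, MeasurableSet s → (V x).real s ≤ E * (V y).real s + δ) {σ : X → ℝ}
    (hσ : ∀ x, |σ x| ≤ 1) :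
    ∫ ω, |∑ x, σ x * (r x ω - min (r x ω) E)| ∂uniformMixture V ≤ Fintype.card X * δ := by
  have hinteg : ∀ x, Integrable (fun ω => r x ω - min (r x ω) E) (uniformMixture V) := fun x =>
    (hr.integrable x).sub ((hr.memLp_min x E).integrable one_le_two)
  calc ∫ ω, |∑ x, σ x * (r x ω - min (r x ω) E)| ∂uniformMixture V
      ≤ ∫ ω, ∑ x, (r x ω - min (r x ω) E) ∂uniformMixture V := by
        refine integral_mono (by fun_prop) (by fun_prop) fun ω =>
          (Finset.abs_sum_le_sum_abs _ _).trans (Finset.sum_le_sum fun x _ => ?_)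
        have hnonneg : 0 ≤ r x ω - min (r x ω) E := sub_nonneg.2 (min_le_left _ _)
        rw [abs_mul, abs_of_nonneg hnonneg]
        exact mul_le_of_le_one_left hnonneg (hσ x)
    _ = ∑ x, ∫ ω, (r x ω - min (r x ω) E) ∂uniformMixture V :=
        integral_finsetSum _ fun x _ => hinteg x
    _ ≤ ∑ _x : X, δ := Finset.sum_le_sum fun x _ => hr.integral_sub_min_le (hV x)
    _ = Fintype.card X * δ := by simp

theorem integral_sum_mul (hr : IsMixtureDensity V r) (σ : X → ℝ) :
    ∫ ω, ∑ x, σ x * r x ω ∂uniformMixture V = ∑ x, σ x := by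
  rw [integral_finsetSum _ fun x _ => (hr.integrable x).const_mul _]
  simp only [integral_const_mul, hr.integral_eq_one, mul_one]

theorem exists_isBalancedSigning_integral_sq_sum_min_le (hr : IsMixtureDensity V r) {E : ℝ}
    (hE : 0 ≤ E) :
    ∃ σ : X → ℝ, IsBalancedSigning σ ∧
      ∫ ω, (∑ x, σ x * min (r x ω) E) ^ 2 ∂uniformMixture V ≤ Fintype.card X * E := by
  obtain ⟨σ, hσ, hle⟩ := exists_isBalancedSigning_integral_sq_sum_le
    (fun x => hr.memLp_min x E) fun x ω => le_min (hr.nonneg x ω) hE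
  refine ⟨σ, hσ, hle.trans ?_⟩
  exact (Finset.sum_le_sum fun x _ => hr.integral_min_sq_le x hE).trans_eq (by simp)

-- The densities are truncated at `E`: the truncated parts have second moment at most `E`, and
-- what is cut off has total mass at most `δ` by privacy.
theorem exists_isBalancedSigning_le_integral_sqrt (hr : IsMixtureDensity V r) {E δ : ℝ}
    (hE : 0 ≤ E) (hV : ∀ x y s, MeasurableSet s → (V x).real s ≤ E * (V y).real s + δ) :
    ∃ σ : X → ℝ, IsBalancedSigning σ ∧ ∀ τ : ℝ, 0 ≤ τ → τ ≤ 1 →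
      1 - τ ^ 2 * E / Fintype.card X - 2 * (τ * δ) ≤
        ∫ ω, √(∑ x, perturbedUniform τ σ x * r x ω) ∂uniformMixture V := by
  obtain ⟨σ, hσ, hσE⟩ := hr.exists_isBalancedSigning_integral_sq_sum_min_le hE
  refine ⟨σ, hσ, fun τ h0 h1 => ?_⟩
  have hσδ := hr.integral_abs_sum_mul_sub_min_le hV hσ.abs_le_one
  have hri := hr.integrable
  have hmin : ∀ x, Integrable (fun ω => min (r x ω) E) (uniformMixture V) :=
    fun x => (hr.memLp_min x E).integrable one_le_two
  have hsplit : ∀ ω, ∑ x, σ x * min (r x ω) E + ∑ x, σ x * (r x ω - min (r x ω) E) =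
      ∑ x, σ x * r x ω := fun ω => by
    simp only [← Finset.sum_add_distrib, ← mul_add, add_sub_cancel]
  have hnonneg : ∀ ω, 0 ≤ 1 + τ / Fintype.card X * ∑ x, σ x * r x ω := fun ω => by
    rw [← hr.sum_perturbedUniform_mul]
    exact Finset.sum_nonneg fun x _ =>
      mul_nonneg ((hσ.perturbedUniform_mem_stdSimplex h0 h1).1 x) (hr.nonneg x ω)
  have hsqrt := one_sub_le_integral_sqrt_one_add_mul
    (memLp_finsetSum Finset.univ fun x _ => (hr.memLp_min x E).const_mul (σ x))
    (v := fun ω => ∑ x, σ x * (r x ω - min (r x ω) E)) (by fun_prop)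
    (div_nonneg h0 (Nat.cast_nonneg (Fintype.card X))) (by simpa only [hsplit] using hnonneg)
    (by simp only [hsplit, hr.integral_sum_mul, hσ.sum_eq_zero])
  simp only [hsplit] at hsqrt
  simp only [hr.sum_perturbedUniform_mul]
  calc 1 - τ ^ 2 * E / Fintype.card X - 2 * (τ * δ)
      = 1 - (τ / Fintype.card X) ^ 2 * (Fintype.card X * E) -
          2 * (τ / Fintype.card X) * (Fintype.card X * δ) := by field_simp
    _ ≤ _ := by gcongr
    _ ≤ _ := hsqrt

end IsMixtureDensity

end PerturbedUniform

section MixtureKernel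

theorem real_bind_withDensity {α β : Type*} [MeasurableSpace α] [MeasurableSpace β]
    {μ : Measure α} {F : α → ℝ} (hF : Measurable F) (h0 : 0 ≤ F) (κ : Kernel α β)
    [IsFiniteKernel κ] {A : Set β} (hA : MeasurableSet A) :
    ((μ.withDensity fun t => ENNReal.ofReal (F t)).bind κ).real A =
      ∫ t, (κ t).real A * F t ∂μ := by
  have hκ : Measurable fun t => (κ t).real A := (κ.measurable_coe hA).ennreal_toReal
  rw [measureReal_def, Measure.bind_apply hA κ.aemeasurable,
    lintegral_withDensity_eq_lintegral_mul _ hF.ennreal_ofReal (κ.measurable_coe hA),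
    integral_eq_lintegral_of_nonneg_ae (ae_of_all _ fun t => mul_nonneg measureReal_nonneg (h0 t))
      (hκ.mul hF).aestronglyMeasurable]
  refine congrArg ENNReal.toReal (lintegral_congr fun t => ?_)
  rw [ENNReal.ofReal_mul measureReal_nonneg, ofReal_measureReal, Pi.mul_apply, mul_comm]

variable {X Γ M : Type*} [Fintype X] [MeasurableSpace Γ] [MeasurableSpace M]

/-- The equal-weight mixture of a finite family of kernels. -/
noncomputable def mixtureKernel (κ : X → Kernel Γ M) : Kernel Γ M where
  toFun γ := uniformMixture fun x => κ x γ
  measurable' := Measure.measurable_of_measurable_coe _ fun s hs => by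
    simp only [uniformMixture_apply]
    exact (Finset.measurable_sum _ fun x _ => (κ x).measurable_coe hs).const_mul _

theorem mixtureKernel_apply (κ : X → Kernel Γ M) (γ : Γ) :
    mixtureKernel κ γ = uniformMixture fun x => κ x γ := rfl

instance [Nonempty X] (κ : X → Kernel Γ M) [∀ x, IsMarkovKernel (κ x)] :
    IsMarkovKernel (mixtureKernel κ) :=
  ⟨fun γ => by rw [mixtureKernel_apply]; infer_instance⟩

theorem compProd_mixtureKernel [Nonempty X] (ρ : Measure Γ) [SFinite ρ] (κ : X → Kernel Γ M)
    [∀ x, IsMarkovKernel (κ x)] :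
    ρ ⊗ₘ mixtureKernel κ = uniformMixture fun x => ρ ⊗ₘ κ x := by
  ext s hs
  have hmeas : ∀ x, Measurable fun γ => κ x γ (Prod.mk γ ⁻¹' s) :=
    fun x => Kernel.measurable_kernel_prodMk_left hs
  simp only [Measure.compProd_apply hs, mixtureKernel_apply, uniformMixture_apply]
  rw [lintegral_const_mul _ (Finset.measurable_fun_sum _ fun x _ => hmeas x),
    lintegral_finsetSum _ fun x _ => hmeas x]

end MixtureKernel

section IidMean

variable {X : Type*} [Fintype X] {n : ℕ} {p : X → ℝ}

/-- The expectation of `F` on a dataset whose `n` entries are drawn independently with the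
weights `p`. -/
noncomputable def iidMean (p : X → ℝ) (F : (Fin n → X) → ℝ) : ℝ :=
  ∑ x, (∏ i, p (x i)) * F x

theorem iidMean_mono (hp : ∀ y, 0 ≤ p y) {F G : (Fin n → X) → ℝ} (h : ∀ x, F x ≤ G x) :
    iidMean p F ≤ iidMean p G :=
  Finset.sum_le_sum fun x _ =>
    mul_le_mul_of_nonneg_left (h x) (Finset.prod_nonneg fun i _ => hp (x i))

theorem iidMean_const_mul (c : ℝ) (F : (Fin n → X) → ℝ) :
    iidMean p (fun x => c * F x) = c * iidMean p F := by
  simp only [iidMean, mul_left_comm _ c, Finset.mul_sum]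

theorem iidMean_add (F G : (Fin n → X) → ℝ) :
    iidMean p (fun x => F x + G x) = iidMean p F + iidMean p G := by
  simp only [iidMean, mul_add, Finset.sum_add_distrib]

theorem iidMean_sum {ι : Type*} (s : Finset ι) (F : ι → (Fin n → X) → ℝ) :
    iidMean p (fun x => ∑ j ∈ s, F j x) = ∑ j ∈ s, iidMean p (F j) := by
  simp only [iidMean, Finset.mul_sum]
  exact Finset.sum_comm

theorem iidMean_prod (g : Fin n → X → ℝ) :
    iidMean p (fun x => ∏ i, g i (x i)) = ∏ i, ∑ y, p y * g i y := by
  classical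
  simp only [iidMean, ← Finset.prod_mul_distrib]
  rw [Finset.prod_univ_sum, Fintype.piFinset_univ]

theorem iidMean_const (hp : ∑ y, p y = 1) (c : ℝ) :
    iidMean p (fun _ : Fin n → X => c) = c := by
  have hone := iidMean_prod (n := n) (p := p) 1
  simp only [Pi.one_apply, mul_one, hp, Finset.prod_const_one] at hone
  simpa [hone] using iidMean_const_mul (p := p) c fun _ : Fin n → X => (1 : ℝ)

end IidMean

namespace Protocol

variable {n : ℕ} {X Γ M : Type*} [MeasurableSpace Γ] [MeasurableSpace M]

instance (P : Protocol n X Γ M) (x : X) : IsProbabilityMeasure (P.view x) := by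
  unfold view; infer_instance

instance (P : Protocol n X Γ M) (x : Fin n → X) : IsProbabilityMeasure (P.output x) := by
  unfold output transcript; infer_instance

theorem IsLocallyDP.real_view_le {P : Protocol n X Γ M} {ε δ : ℝ} (hP : P.IsLocallyDP ε δ)
    (x y : X) {S : Set (Γ × M)} (hS : MeasurableSet S) :
    (P.view x).real S ≤ Real.exp ε * (P.view y).real S + δ :=
  hP (fun _ => x) (fun _ => y) ⟨1, 0, fun j hj => absurd (Subsingleton.elim j 0) hj⟩ S hS

variable [Fintype X]

theorem measurable_prod_density {P : Protocol n X Γ M} {r : X → Γ × M → ℝ}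
    (hr : IsMixtureDensity P.view r) (x : Fin n → X) :
    Measurable fun t : Γ × (Fin n → M) => ∏ i, r (x i) (t.1, t.2 i) :=
  Finset.measurable_fun_prod _ fun i _ => (hr.measurable _).comp (by fun_prop)

variable [Nonempty X]

/-- The joint law of the coin and all messages when, given the coin, every user sends the message
of an independent uniformly random input. -/
noncomputable def uniformTranscript (P : Protocol n X Γ M) : Measure (Γ × (Fin n → M)) :=
  P.coin ⊗ₘ piKernel fun _ => mixtureKernel P.randomizer

instance (P : Protocol n X Γ M) : IsProbabilityMeasure P.uniformTranscript := by
  unfold uniformTranscript; infer_instance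

theorem compProd_mixtureKernel_randomizer (P : Protocol n X Γ M) :
    P.coin ⊗ₘ mixtureKernel P.randomizer = uniformMixture P.view :=
  compProd_mixtureKernel _ _

variable {P : Protocol n X Γ M} {r : X → Γ × M → ℝ}

theorem transcript_eq_withDensity (hr : IsMixtureDensity P.view r) (x : Fin n → X) :
    P.transcript x = P.uniformTranscript.withDensity
      fun t => ENNReal.ofReal (∏ i, r (x i) (t.1, t.2 i)) := by
  simp only [ENNReal.ofReal_prod_of_nonneg fun i _ => hr.nonneg (x i) _]
  refine compProd_piKernel_eq_withDensity
    (r := fun i ω => ENNReal.ofReal (r (x i) ω)) (fun i => (hr.measurable _).ennreal_ofReal)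
    fun i => ?_
  rw [P.compProd_mixtureKernel_randomizer]
  exact hr.eq_withDensity (x i)

theorem integrable_prod_density (hr : IsMixtureDensity P.view r) (x : Fin n → X) :
    Integrable (fun t : Γ × (Fin n → M) => ∏ i, r (x i) (t.1, t.2 i)) P.uniformTranscript := by
  refine .of_bound (measurable_prod_density hr x).aestronglyMeasurable
    (∏ _i : Fin n, (Fintype.card X : ℝ)) (ae_of_all _ fun t => ?_)
  rw [Real.norm_of_nonneg (Finset.prod_nonneg fun i _ => hr.nonneg _ _)]
  exact Finset.prod_le_prod (fun i _ => hr.nonneg _ _) fun i _ => hr.le_card _ _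

theorem real_output_eq_integral (hr : IsMixtureDensity P.view r) (x : Fin n → X) {A : Set ℝ}
    (hA : MeasurableSet A) :
    (P.output x).real A =
      ∫ t, (P.analyzer t).real A * ∏ i, r (x i) (t.1, t.2 i) ∂P.uniformTranscript := by
  rw [output, transcript_eq_withDensity hr]
  exact real_bind_withDensity (measurable_prod_density hr x)
    (fun t => Finset.prod_nonneg fun i _ => hr.nonneg _ _) P.analyzer hA

theorem integrable_prod_sum_mul_density (hr : IsMixtureDensity P.view r) (p : X → ℝ) :
    Integrable (fun t : Γ × (Fin n → M) => ∏ i, ∑ y, p y * r y (t.1, t.2 i))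
      P.uniformTranscript := by
  simp only [← iidMean_prod]
  exact integrable_finsetSum _ fun x _ => (integrable_prod_density hr x).const_mul _

theorem integrable_real_analyzer_mul {F : Γ × (Fin n → M) → ℝ}
    (hF : Integrable F P.uniformTranscript) {A : Set ℝ} (hA : MeasurableSet A) :
    Integrable (fun t => (P.analyzer t).real A * F t) P.uniformTranscript :=
  hF.bdd_mul (c := 1) (P.analyzer.measurable_coe hA).ennreal_toReal.aestronglyMeasurable
    (ae_of_all _ fun t => by
      change ‖(P.analyzer t).real A‖ ≤ 1
      rw [Real.norm_of_nonneg measureReal_nonneg]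
      exact measureReal_le_one)

theorem iidMean_real_output (hr : IsMixtureDensity P.view r) (p : X → ℝ) {A : Set ℝ}
    (hA : MeasurableSet A) :
    iidMean p (fun x => (P.output x).real A) =
      ∫ t, (P.analyzer t).real A * ∏ i, ∑ y, p y * r y (t.1, t.2 i) ∂P.uniformTranscript := by
  simp only [← iidMean_prod, ← iidMean_const_mul]
  simp only [iidMean]
  rw [integral_finsetSum _ fun x _ =>
    (integrable_real_analyzer_mul (integrable_prod_density hr x) hA).const_mul _]
  simp only [integral_const_mul, real_output_eq_integral hr _ hA]

theorem abs_iidMean_real_output_sub_le (hr : IsMixtureDensity P.view r) (p q : X → ℝ) {A : Set ℝ}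
    (hA : MeasurableSet A) :
    |iidMean p (fun x => (P.output x).real A) - iidMean q (fun x => (P.output x).real A)| ≤
      ∫ t, |(∏ i, ∑ y, p y * r y (t.1, t.2 i)) - ∏ i, ∑ y, q y * r y (t.1, t.2 i)|
        ∂P.uniformTranscript := by
  have hinteg := fun p => integrable_prod_sum_mul_density hr p
  have hmul := fun p => integrable_real_analyzer_mul (hinteg p) hA
  rw [iidMean_real_output hr p hA, iidMean_real_output hr q hA,
    ← integral_sub (hmul p) (hmul q)]
  refine abs_integral_le_integral_abs.trans
    (integral_mono ((hmul p).sub (hmul q)).abs ((hinteg p).sub (hinteg q)).abs fun t => ?_)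
  simp only
  rw [← mul_sub, abs_mul, abs_of_nonneg measureReal_nonneg]
  exact mul_le_of_le_one_left (abs_nonneg _) measureReal_le_one

theorem integral_prod_sum_mul_density (hr : IsMixtureDensity P.view r) {p : X → ℝ}
    (hp : ∑ y, p y = 1) :
    ∫ t, ∏ i, ∑ y, p y * r y (t.1, t.2 i) ∂P.uniformTranscript = 1 := by
  have hmean := iidMean_real_output hr p .univ
  simp only [probReal_univ, one_mul, iidMean_const hp] at hmean
  exact hmean.symm

theorem IsLocallyDP.exists_isBalancedSigning_sq_iidMean_sub_le {ε δ : ℝ}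
    (hP : P.IsLocallyDP ε δ) :
    ∃ σ : X → ℝ, IsBalancedSigning σ ∧ ∀ τ : ℝ, 0 ≤ τ → τ ≤ 1 → ∀ A, MeasurableSet A →
      (iidMean (perturbedUniform τ σ) (fun x => (P.output x).real A) -
        iidMean (perturbedUniform 0 σ) (fun x => (P.output x).real A)) ^ 2 ≤
          8 * n * (τ ^ 2 * Real.exp ε / Fintype.card X + 2 * (τ * δ)) := by
  obtain ⟨r, hr⟩ := exists_isMixtureDensity P.view
  obtain ⟨σ, hσ, hsqrt⟩ := hr.exists_isBalancedSigning_le_integral_sqrt (Real.exp_pos ε).le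
    fun x y s hs => hP.real_view_le x y hs
  refine ⟨σ, hσ, fun τ h0 h1 A hA => ?_⟩
  have hp := hσ.perturbedUniform_mem_stdSimplex h0 h1
  have hdist := abs_iidMean_real_output_sub_le hr (perturbedUniform τ σ) (perturbedUniform 0 σ) hA
  have hone : ∀ ω, ∑ y, perturbedUniform 0 σ y * r y ω = 1 := fun ω => by
    rw [hr.sum_perturbedUniform_mul, zero_div, zero_mul, add_zero]
  have haff := sq_integral_abs_prod_sub_one_le
    (f := fun ω => ∑ y, perturbedUniform τ σ y * r y ω)
    (fun ω => Finset.sum_nonneg fun y _ => mul_nonneg (hp.1 y) (hr.nonneg y ω))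
    (P.compProd_mixtureKernel_randomizer ▸
      integrable_finsetSum _ fun y _ => (hr.integrable y).const_mul _)
    (integral_prod_sum_mul_density hr hp.2)
  simp only [hone, Finset.prod_const_one] at hdist
  rw [P.compProd_mixtureKernel_randomizer] at haff
  calc _ ≤ (∫ t, |(∏ i, ∑ y, perturbedUniform τ σ y * r y (t.1, t.2 i)) - 1|
          ∂P.uniformTranscript) ^ 2 := sq_le_sq' (neg_le_of_abs_le hdist) (le_of_abs_le hdist)
    _ ≤ 8 * n * (1 - ∫ ω, √(∑ y, perturbedUniform τ σ y * r y ω) ∂uniformMixture P.view) := haff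
    _ ≤ _ := by
        have := hsqrt τ h0 h1
        gcongr
        linarith

end Protocol

section MissingCount

theorem iidMean_ite_le_abs_sub_iidMean_le {X : Type*} [Fintype X] {n : ℕ} {p : X → ℝ}
    (hp : p ∈ stdSimplex ℝ X) (F : (Fin n → X) → ℝ) {t : ℝ} (ht : 0 < t) :
    iidMean p (fun x => if t ≤ |F x - iidMean p F| then 1 else 0) ≤
      (iidMean p (fun x => F x ^ 2) - iidMean p F ^ 2) / t ^ 2 := by
  set m := iidMean p F
  have hvar : iidMean p (fun x => (F x - m) ^ 2) = iidMean p (fun x => F x ^ 2) - m ^ 2 := by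
    have hexpand : ∀ x, (F x - m) ^ 2 = F x ^ 2 + ((-2 * m) * F x + m ^ 2) := fun x => by ring
    simp only [hexpand, iidMean_add, iidMean_const_mul, iidMean_const hp.2]
    ring
  rw [le_div_iff₀' (pow_pos ht 2), ← hvar, ← iidMean_const_mul]
  refine iidMean_mono hp.1 fun x => ?_
  split_ifs with h
  · rw [mul_one, ← sq_abs (F x - m)]
    exact pow_le_pow_left₀ ht.le h 2
  · rw [mul_zero]
    exact sq_nonneg _

variable {X : Type*} [Fintype X] [DecidableEq X] {n : ℕ}

/-- The number of elements of `X` that do not occur in the dataset `x`, a real number. -/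
noncomputable def missingCount (x : Fin n → X) : ℝ := ((Finset.univ.image x)ᶜ.card : ℝ)

theorem countDistinct_eq_sub_missingCount {D : ℕ} (x : Fin n → Fin D) :
    countDistinct n D x = D - missingCount x := by
  rw [countDistinct, missingCount, eq_sub_iff_add_eq]
  exact_mod_cast (Finset.card_add_card_compl _).trans (Fintype.card_fin D)

theorem missingCount_eq_sum (x : Fin n → X) :
    missingCount x = ∑ y, if ∀ i, x i ∉ ({y} : Finset X) then 1 else 0 := by
  rw [missingCount, Finset.sum_boole]
  congr 2
  ext y
  simp

theorem missingCount_sq_eq_sum (x : Fin n → X) :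
    missingCount x ^ 2 = ∑ y, ∑ z, if ∀ i, x i ∉ ({y, z} : Finset X) then 1 else 0 := by
  rw [sq, missingCount_eq_sum, Finset.sum_mul_sum]
  refine Finset.sum_congr rfl fun y _ => Finset.sum_congr rfl fun z _ => ?_
  simp only [mul_ite, mul_one, mul_zero, ← ite_and, Finset.mem_singleton, Finset.mem_insert,
    not_or, forall_and]
  simp only [and_comm]

theorem iidMean_avoid {p : X → ℝ} (hp : ∑ y, p y = 1) (s : Finset X) :
    iidMean p (fun x : Fin n → X => if ∀ i, x i ∉ s then 1 else 0) =
      (1 - ∑ y ∈ s, p y) ^ n := by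
  have hprod : ∀ x : Fin n → X, (if ∀ i, x i ∉ s then (1 : ℝ) else 0) =
      ∏ i, if x i ∉ s then 1 else 0 := fun x => by
    simp only [Finset.prod_ite_zero, Finset.prod_const_one, Finset.mem_univ, true_implies]
  have hsum : ∑ y, p y * (if y ∉ s then 1 else 0) = 1 - ∑ y ∈ s, p y := by
    have hcompl : ∑ y, p y * (if y ∉ s then 1 else 0) = ∑ y ∈ sᶜ, p y := by
      simp only [mul_ite, mul_one, mul_zero, ← Finset.mem_compl, Finset.sum_ite_mem,
        Finset.univ_inter]
    rw [hcompl, eq_sub_iff_add_eq, Finset.sum_compl_add_sum, hp]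
  simp only [hprod]
  rw [iidMean_prod fun _ y => if y ∉ s then (1 : ℝ) else 0, Finset.prod_const, Finset.card_fin,
    hsum]

theorem iidMean_missingCount {p : X → ℝ} (hp : ∑ y, p y = 1) :
    iidMean p (missingCount : (Fin n → X) → ℝ) = ∑ y, (1 - p y) ^ n := by
  simp only [funext missingCount_eq_sum, iidMean_sum, iidMean_avoid hp, Finset.sum_singleton]

theorem iidMean_missingCount_sq_le {p : X → ℝ} (hp : p ∈ stdSimplex ℝ X) :
    iidMean p (fun x : Fin n → X => missingCount x ^ 2) ≤
      iidMean p (missingCount : (Fin n → X) → ℝ) ^ 2 + Fintype.card X := by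
  have hcell : ∀ y z, (1 - ∑ w ∈ {y, z}, p w) ^ n ≤
      (1 - p y) ^ n * (1 - p z) ^ n + if y = z then 1 else 0 := by
    intro y z
    have hpair : 0 ≤ 1 - ∑ w ∈ {y, z}, p w := by
      rw [sub_nonneg, ← hp.2]
      exact Finset.sum_le_univ_sum_of_nonneg hp.1
    have hprod : 0 ≤ (1 - p y) ^ n * (1 - p z) ^ n := by
      have hsub : ∀ w, 0 ≤ 1 - p w := fun w => sub_nonneg.2 (mem_Icc_of_mem_stdSimplex hp w).2
      exact mul_nonneg (pow_nonneg (hsub y) n) (pow_nonneg (hsub z) n)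
    rcases eq_or_ne y z with rfl | hyz
    · have hle : (1 - ∑ w ∈ {y, y}, p w) ^ n ≤ 1 :=
        pow_le_one₀ hpair (sub_le_self _ (Finset.sum_nonneg fun w _ => hp.1 w))
      rw [if_pos rfl]
      linarith
    · rw [if_neg hyz, add_zero, ← mul_pow]
      refine pow_le_pow_left₀ hpair ?_ n
      rw [Finset.sum_pair hyz]
      linarith [mul_nonneg (hp.1 y) (hp.1 z)]
  simp only [missingCount_sq_eq_sum, iidMean_sum, iidMean_avoid hp.2, iidMean_missingCount hp.2]
  refine (Finset.sum_le_sum fun y _ => Finset.sum_le_sum fun z _ => hcell y z).trans_eq ?_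
  simp [Finset.sum_add_distrib, sq, Finset.sum_mul_sum]

theorem iidMean_missingCount_deviation_le {p : X → ℝ} (hp : p ∈ stdSimplex ℝ X) {t : ℝ}
    (ht : 0 < t) :
    iidMean p (fun x : Fin n → X =>
      if t ≤ |missingCount x - iidMean p (missingCount : (Fin n → X) → ℝ)| then 1 else 0) ≤
        Fintype.card X / t ^ 2 := by
  refine (iidMean_ite_le_abs_sub_iidMean_le hp missingCount ht).trans ?_
  gcongr
  linarith [iidMean_missingCount_sq_le (n := n) hp]

end MissingCount

section MissingCountGap

theorem taylor_two_le_pow {a c y : ℝ} (hc : 0 ≤ c) (ha : c ≤ a) (hy : c ≤ y) (k : ℕ) :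
    a ^ (k + 2) + (k + 2) * a ^ (k + 1) * (y - a) + (k + 2) * (k + 1) / 2 * c ^ k * (y - a) ^ 2 ≤
      y ^ (k + 2) := by
  induction k with
  | zero => exact le_of_eq (by push_cast; ring)
  | succ k ih =>
    have hpow : c ^ (k + 1) ≤ a ^ (k + 1) := pow_le_pow_left₀ hc ha _
    have hy0 : 0 ≤ y := hc.trans hy
    calc _ = a ^ (k + 3) + (k + 3) * a ^ (k + 2) * (y - a) +
          ((k + 2) * c ^ (k + 1) + (k + 2) * (k + 1) / 2 * (c * c ^ k)) * (y - a) ^ 2 := by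
          push_cast
          ring
      _ ≤ a ^ (k + 3) + (k + 3) * a ^ (k + 2) * (y - a) +
          ((k + 2) * a ^ (k + 1) + (k + 2) * (k + 1) / 2 * (y * c ^ k)) * (y - a) ^ 2 := by
          gcongr
      _ = y * (a ^ (k + 2) + (k + 2) * a ^ (k + 1) * (y - a) +
          (k + 2) * (k + 1) / 2 * c ^ k * (y - a) ^ 2) := by ring
      _ ≤ y * y ^ (k + 2) := mul_le_mul_of_nonneg_left ih hy0
      _ = y ^ (k + 1 + 2) := by ring

theorem one_ninth_le_one_sub_two_div_pow (k : ℕ) : (1 : ℝ) / 9 ≤ (1 - 2 / (k + 2)) ^ k := by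
  rcases k.eq_zero_or_pos with rfl | hk
  · norm_num
  have : (0 : ℝ) < k := by exact_mod_cast hk
  have hbase : 1 - 2 / ((k : ℝ) + 2) = (1 + 2 / (k : ℝ))⁻¹ := by
    field_simp
    ring
  have hexp : (1 + 2 / (k : ℝ)) ^ k ≤ 9 := by
    calc (1 + 2 / (k : ℝ)) ^ k ≤ Real.exp (2 / k) ^ k := by
          gcongr
          linarith [Real.add_one_le_exp (2 / (k : ℝ))]
      _ = Real.exp 1 ^ 2 := by
          rw [← Real.exp_nat_mul, ← Real.exp_nat_mul]
          congr 1
          field_simp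
          norm_num
      _ ≤ 3 ^ 2 := by
          gcongr
          exact Real.exp_one_lt_three.le
      _ = 9 := by norm_num
  rw [hbase, inv_pow, one_div]
  exact inv_anti₀ (by positivity) hexp

variable {X : Type*} [Fintype X] [DecidableEq X]

theorem IsBalancedSigning.le_iidMean_missingCount_sub {σ : X → ℝ} (hσ : IsBalancedSigning σ)
    (hX : 2 ≤ Fintype.card X) {τ : ℝ} (h0 : 0 ≤ τ) (h1 : τ ≤ 1) (k : ℕ) :
    (Fintype.card X - 1) *
        ((k + 2) * (k + 1) / 2 * (1 - 2 / Fintype.card X) ^ k * (τ / Fintype.card X) ^ 2) ≤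
      iidMean (perturbedUniform τ σ) (missingCount : (Fin (k + 2) → X) → ℝ) -
        iidMean (perturbedUniform 0 σ) (missingCount : (Fin (k + 2) → X) → ℝ) := by
  have : Nonempty X := Fintype.card_pos_iff.1 (by omega)
  have hX' : (2 : ℝ) ≤ Fintype.card X := by exact_mod_cast hX
  rw [iidMean_missingCount (hσ.perturbedUniform_mem_stdSimplex h0 h1).2,
    iidMean_missingCount (hσ.perturbedUniform_mem_stdSimplex le_rfl zero_le_one).2,
    ← Finset.sum_sub_distrib]
  simp only [perturbedUniform, zero_mul, add_zero]
  set D := (Fintype.card X : ℝ)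
  have hc : 0 ≤ 1 - 2 / D := by
    rw [sub_nonneg, div_le_one (by linarith)]
    exact hX'
  set A := (k + 2) * (1 - 1 / D) ^ (k + 1)
  set B := (k + 2) * (k + 1) / 2 * (1 - 2 / D) ^ k * (τ / D) ^ 2
  have hcell : ∀ y, A * (-(τ / D)) * σ y + B * σ y ^ 2 ≤
      (1 - (1 + τ * σ y) / D) ^ (k + 2) - (1 - 1 / D) ^ (k + 2) := fun y => by
    have hσy : τ * σ y ≤ 1 := by nlinarith [le_of_abs_le (hσ.abs_le_one y)]
    have hle := taylor_two_le_pow (a := 1 - 1 / D) (y := 1 - (1 + τ * σ y) / D) hc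
      (by gcongr; norm_num) (by gcongr; linarith) k
    have hdiff : 1 - (1 + τ * σ y) / D - (1 - 1 / D) = -(τ / D) * σ y := by ring
    rw [hdiff] at hle
    simp only [A, B]
    linarith
  have hB : 0 ≤ B := by positivity
  calc (D - 1) * B ≤ (∑ y, σ y ^ 2) * B :=
        mul_le_mul_of_nonneg_right hσ.card_sub_one_le_sum_sq hB
    _ = ∑ y, (A * (-(τ / D)) * σ y + B * σ y ^ 2) := by
        rw [Finset.sum_add_distrib, ← Finset.mul_sum, ← Finset.mul_sum, hσ.sum_eq_zero]
        ring
    _ ≤ _ := Finset.sum_le_sum fun y _ => hcell y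

theorem IsBalancedSigning.mul_sq_div_le_iidMean_missingCount_sub {σ : X → ℝ}
    (hσ : IsBalancedSigning σ) {n : ℕ} (hn : 2 ≤ n) (hcard : Fintype.card X = n) {τ : ℝ}
    (h0 : 0 ≤ τ) (h1 : τ ≤ 1) :
    n * τ ^ 2 / 72 ≤
      iidMean (perturbedUniform τ σ) (missingCount : (Fin n → X) → ℝ) -
        iidMean (perturbedUniform 0 σ) (missingCount : (Fin n → X) → ℝ) := by
  obtain ⟨k, rfl⟩ : ∃ k, n = k + 2 := ⟨n - 2, by omega⟩
  refine le_trans ?_ (hσ.le_iidMean_missingCount_sub (by omega) h0 h1 k)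
  rw [hcard]
  push_cast
  calc (k + 2) * τ ^ 2 / 72 ≤
      (k + 2 - 1) * ((k + 2) * (k + 1) / 2 * (1 / 9) * (τ / (k + 2)) ^ 2) := by
        have : (k + 2 - 1) * ((k + 2) * (k + 1) / 2 * (1 / 9) * (τ / (k + 2)) ^ 2) -
            (k + 2) * τ ^ 2 / 72 = τ ^ 2 * (k * (3 * k + 4)) / (72 * (k + 2)) := by
          field_simp
          ring
        have : 0 ≤ τ ^ 2 * (k * (3 * k + 4)) / (72 * (k + 2)) := by positivity
        linarith
    _ ≤ _ := by
        have : (0 : ℝ) ≤ k + 2 - 1 := by linarith [Nat.cast_nonneg (α := ℝ) k]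
        gcongr
        exact one_ninth_le_one_sub_two_div_pow k

end MissingCountGap

section Sensitivity

theorem Neighboring.symm {n : ℕ} {X : Type*} {x x' : Fin n → X} (h : Neighboring x x') :
    Neighboring x' x := by
  obtain ⟨σ, i, hi⟩ := h
  exact ⟨σ.symm, σ i, fun j hj => by
    rw [hi _ fun h => hj (by rw [← h, σ.apply_symm_apply]), σ.apply_symm_apply]⟩

theorem countDistinct_le_add_one {n D : ℕ} {x x' : Fin n → Fin D} (h : Neighboring x x') :
    countDistinct n D x' ≤ countDistinct n D x + 1 := by
  obtain ⟨σ, i, hi⟩ := h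
  have hsub : Finset.univ.image x' ⊆ insert (x' i) (Finset.univ.image x) := fun y hy => by
    obtain ⟨j, -, rfl⟩ := Finset.mem_image.1 hy
    rcases eq_or_ne j i with rfl | hj
    · exact Finset.mem_insert_self _ _
    · rw [hi j hj]
      exact Finset.mem_insert_of_mem (Finset.mem_image_of_mem _ (Finset.mem_univ _))
  unfold countDistinct
  exact_mod_cast (Finset.card_le_card hsub).trans (Finset.card_insert_le _ _)

theorem exists_neighboring_abs_countDistinct_sub_eq_one {n D : ℕ} (hn : 2 ≤ n) (hD : 2 ≤ D) :
    ∃ x x' : Fin n → Fin D,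
      Neighboring x x' ∧ 1 = |countDistinct n D x - countDistinct n D x'| := by
  obtain ⟨m, rfl⟩ := Nat.exists_eq_add_of_le' hn
  obtain ⟨d, rfl⟩ := Nat.exists_eq_add_of_le' hD
  refine ⟨fun _ => 0, Fin.cons 1 fun _ => 0, ⟨1, 0, fun j hj => ?_⟩, ?_⟩
  · obtain ⟨k, rfl⟩ := Fin.exists_succ_eq.2 hj
    rfl
  · have himage :
        Finset.univ.image (Fin.cons 1 fun _ => 0 : Fin (m + 2) → Fin (d + 2)) = {1, 0} := by
      rw [← Finset.coe_inj]
      simp [Fin.range_cons]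
    simp only [countDistinct, himage]
    rw [Finset.image_const Finset.univ_nonempty, Finset.card_pair (by simp)]
    norm_num

theorem isGlobalSensitivity_countDistinct {n D : ℕ} (hn : 2 ≤ n) (hD : 2 ≤ D) :
    IsGlobalSensitivity (countDistinct n D) 1 := by
  refine IsGreatest.isLUB ⟨exists_neighboring_abs_countDistinct_sub_eq_one hn hD, ?_⟩
  rintro _ ⟨x, x', h, rfl⟩
  exact abs_sub_le_iff.2 ⟨sub_le_iff_le_add'.2 (countDistinct_le_add_one h.symm),
    sub_le_iff_le_add'.2 (countDistinct_le_add_one h)⟩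

end Sensitivity

section LowerBound

variable {n D : ℕ} {Γ M : Type*} [MeasurableSpace Γ] [MeasurableSpace M]

theorem Protocol.Solves.le_iidMean_real_output_ball {P : Protocol n (Fin D) Γ M} {e : ℝ}
    (hs : P.Solves (countDistinct n D) e) {p : Fin D → ℝ} (hp : p ∈ stdSimplex ℝ (Fin D)) {t : ℝ}
    (ht : 0 < t) :
    0.99 - D / t ^ 2 ≤ iidMean p fun x =>
      (P.output x).real
        (Metric.ball (D - iidMean p (missingCount : (Fin n → Fin D) → ℝ)) (t + e)) := by
  set m := iidMean p (missingCount : (Fin n → Fin D) → ℝ)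
  have hx : ∀ x, 0.99 + (-1) * (if t ≤ |missingCount x - m| then 1 else 0) ≤
      (P.output x).real (Metric.ball (D - m) (t + e)) := fun x => by
    split_ifs with h
    · linarith [measureReal_nonneg (μ := P.output x) (s := Metric.ball (D - m) (t + e))]
    · rw [mul_zero, add_zero]
      refine (hs x).trans (measureReal_mono fun z (hz : |z - countDistinct n D x| ≤ e) => ?_)
      have hdist : z - (D - m) = z - countDistinct n D x - (missingCount x - m) := by
        rw [countDistinct_eq_sub_missingCount]
        ring
      rw [Metric.mem_ball, Real.dist_eq, hdist]
      exact (abs_sub _ _).trans_lt (by linarith)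
  have hdev := iidMean_missingCount_deviation_le (n := n) hp ht
  rw [Fintype.card_fin] at hdev
  have hmean := iidMean_mono hp.1 hx
  rw [iidMean_add, iidMean_const hp.2, iidMean_const_mul] at hmean
  linarith

theorem Protocol.Solves.exists_le_iidMean_real_output_sub {P : Protocol n (Fin D) Γ M} {e : ℝ}
    (hs : P.Solves (countDistinct n D) e) {p q : Fin D → ℝ} (hp : p ∈ stdSimplex ℝ (Fin D))
    (hq : q ∈ stdSimplex ℝ (Fin D)) {t : ℝ} (ht : 0 < t)
    (hsep : 2 * (t + e) ≤ |iidMean p (missingCount : (Fin n → Fin D) → ℝ) -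
      iidMean q (missingCount : (Fin n → Fin D) → ℝ)|) :
    ∃ A, MeasurableSet A ∧ 0.98 - 2 * D / t ^ 2 ≤
      iidMean p (fun x => (P.output x).real A) - iidMean q (fun x => (P.output x).real A) := by
  set B := Metric.ball (D - iidMean p (missingCount : (Fin n → Fin D) → ℝ)) (t + e)
  set B' := Metric.ball (D - iidMean q (missingCount : (Fin n → Fin D) → ℝ)) (t + e)
  have hdisj : Disjoint B B' := Metric.ball_disjoint_ball <| by
    rw [Real.dist_eq, sub_sub_sub_cancel_left, abs_sub_comm, ← two_mul]
    exact hsep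
  have hpB := hs.le_iidMean_real_output_ball hp ht
  have hqB' := hs.le_iidMean_real_output_ball hq ht
  have hle : ∀ x, (P.output x).real B + (P.output x).real B' ≤ 1 := fun x => by
    rw [← measureReal_union hdisj measurableSet_ball]
    exact measureReal_le_one
  have hqsum := iidMean_mono hq.1 hle
  rw [iidMean_add, iidMean_const hq.2] at hqsum
  refine ⟨B, measurableSet_ball, ?_⟩
  rw [mul_div_assoc]
  linarith

theorem Protocol.IsLocallyDP.half_lt_of_solves_countDistinct {P : Protocol n (Fin n) Γ M}
    {ε δ e : ℝ} (hP : P.IsLocallyDP ε δ) (hs : P.Solves (countDistinct n n) e) (hn : 2 ≤ n)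
    {τ t : ℝ} (h0 : 0 ≤ τ) (h1 : τ ≤ 1) (ht : 0 < t) (hsep : 2 * (t + e) ≤ n * τ ^ 2 / 72)
    (hdev : 10 * n ≤ t ^ 2) :
    1 / 2 < 8 * (τ ^ 2 * Real.exp ε + 2 * τ * (n * δ)) := by
  have : (0 : ℝ) < n := by exact_mod_cast (by omega : 0 < n)
  have : Nonempty (Fin n) := ⟨⟨0, by omega⟩⟩
  obtain ⟨σ, hσ, hclose⟩ := hP.exists_isBalancedSigning_sq_iidMean_sub_le
  have hgap := hσ.mul_sq_div_le_iidMean_missingCount_sub hn (Fintype.card_fin n) h0 h1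
  obtain ⟨A, hA, hle⟩ := hs.exists_le_iidMean_real_output_sub
    (hσ.perturbedUniform_mem_stdSimplex h0 h1)
    (hσ.perturbedUniform_mem_stdSimplex le_rfl zero_le_one) ht
    (hsep.trans (hgap.trans (le_abs_self _)))
  have hratio : 2 * n / t ^ 2 ≤ 0.2 := by
    rw [div_le_iff₀ (pow_pos ht 2)]
    linarith
  have hsq := pow_le_pow_left₀ (by norm_num) ((by linarith : (0.78 : ℝ) ≤ _).trans hle) 2
  have hmul : 8 * n * (τ ^ 2 * Real.exp ε / n + 2 * (τ * δ)) =
      8 * (τ ^ 2 * Real.exp ε + 2 * τ * (n * δ)) := by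
    field_simp
  rw [← hmul]
  have hle' := hsq.trans (hclose τ h0 h1 A hA)
  rw [Fintype.card_fin] at hle'
  exact (by norm_num : (1 / 2 : ℝ) < 0.78 ^ 2).trans_le hle'

theorem Protocol.IsLocallyDP.not_solves_countDistinct {P : Protocol n (Fin n) Γ M} {ε δ e : ℝ}
    (hP : P.IsLocallyDP ε δ) (hε : 0 ≤ ε) (hn : Real.exp (2 * ε) ≤ n / 4000000000)
    (hδ : n * δ ≤ 1 / 16) (he : e ≤ n / (20000 * Real.exp ε)) :
    ¬ P.Solves (countDistinct n n) e := fun hs => by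
  set E := Real.exp ε with hE_def
  have hE : 1 ≤ E := Real.one_le_exp hε
  have hE0 : 0 < E := Real.exp_pos ε
  rw [two_mul, Real.exp_add, ← hE_def, le_div_iff₀ (by norm_num)] at hn
  have hn2 : (2 : ℝ) ≤ n := by nlinarith
  obtain ⟨τ, hτ0, hτ8, hτE⟩ : ∃ τ : ℝ, 0 ≤ τ ∧ τ ≤ 1 / 8 ∧ τ ^ 2 = 1 / (64 * E) := by
    refine ⟨1 / (8 * √E), by positivity, ?_, ?_⟩
    · gcongr
      linarith [Real.one_le_sqrt.2 hE]
    · rw [div_pow, mul_pow, Real.sq_sqrt hE0.le]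
      norm_num
  have hsep : 2 * (n / (20000 * E) + e) ≤ n * τ ^ 2 / 72 := by
    calc 2 * (n / (20000 * E) + e) ≤ 2 * (n / (20000 * E) + n / (20000 * E)) := by gcongr
      _ = n / (5000 * E) := by ring
      _ ≤ n / (4608 * E) := by
          gcongr
          norm_num
      _ = n * τ ^ 2 / 72 := by
          rw [hτE]
          ring
  have hdev : 10 * n ≤ (n / (20000 * E)) ^ 2 := by
    rw [div_pow, le_div_iff₀ (by positivity)]
    nlinarith
  have hlt := hP.half_lt_of_solves_countDistinct hs (by exact_mod_cast hn2) hτ0 (by linarith)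
    (by positivity) hsep hdev
  have hsmall : τ ^ 2 * E = 1 / 64 := by
    rw [hτE]
    field_simp
  rw [← hE_def, hsmall] at hlt
  nlinarith

end LowerBound

section Asymptotics

variable {α : Type*} {l : Filter α} {f g h : α → ℝ}

theorem isBigO_exp_one (hf : f =O[l] fun _ => (1 : ℝ)) :
    (fun a => Real.exp (f a)) =O[l] fun _ => (1 : ℝ) :=
  Real.isBigO_exp_comp_one.2 <|
    ((isBigO_one_iff ℝ).1 hf : l.IsBoundedUnder (· ≤ ·) fun a => ‖f a‖).mono_le <|
      .of_forall fun a => Real.le_norm_self (f a)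

theorem isLittleO_exp_of_tendsto_atTop (hf : f =O[l] fun _ => (1 : ℝ)) (hg : Tendsto g l atTop) :
    (fun a => Real.exp (f a)) =o[l] g :=
  (isBigO_exp_one hf).trans_isLittleO <|
    (isLittleO_one_left_iff ℝ).2 (tendsto_norm_atTop_atTop.comp hg)

theorem isLittleO_div_exp (hf : f =O[l] fun _ => (1 : ℝ)) (hgh : g =o[l] h) :
    g =o[l] fun a => h a / Real.exp (f a) := by
  refine hgh.trans_isBigO ?_
  simpa [div_mul_cancel₀ _ (Real.exp_ne_zero _)] using
    (isBigO_refl (fun a => h a / Real.exp (f a)) l).mul (isBigO_exp_one hf)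

theorem eventually_exp_two_mul_le {a c : ℝ} (ha : a < 1 / 2) (hc : 0 < c) :
    ∀ᶠ n : ℕ in atTop, ∀ ε : ℝ, ε ≤ a * Real.log n → Real.exp (2 * ε) ≤ c * n := by
  have hlim := ((tendsto_rpow_atTop (by linarith : 0 < 1 - 2 * a)).comp
    (tendsto_natCast_atTop_atTop (R := ℝ))).eventually_ge_atTop c⁻¹
  filter_upwards [hlim, eventually_gt_atTop 0] with n hn hn0 ε hε
  have hn0' : (0 : ℝ) < n := by exact_mod_cast hn0
  calc Real.exp (2 * ε) ≤ (n : ℝ) ^ (2 * a) := by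
        rw [Real.rpow_def_of_pos hn0']
        exact Real.exp_le_exp.2 (by linarith)
    _ ≤ c * (n : ℝ) ^ (1 - 2 * a) * (n : ℝ) ^ (2 * a) := by
        refine le_mul_of_one_le_left (by positivity) ?_
        rwa [Function.comp_apply, inv_le_iff_one_le_mul₀' hc] at hn
    _ = c * n := by rw [mul_assoc, ← Real.rpow_add hn0', sub_add_cancel, Real.rpow_one]

end Asymptotics

end LocalDP

theorem theorem1_general :
    (∀ ε δ err : ℕ → ℝ,
      (∀ n, 0 ≤ ε n) →
      ((fun n => Real.exp (2 * ε n)) =o[atTop] fun n => (n : ℝ)) →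
      (δ =o[atTop] fun n => 1 / (n : ℝ)) →
      (err =o[atTop] fun n => n / Real.exp (ε n)) →
      ∀ᶠ n : ℕ in atTop,
        ∀ (Γ : Type u) [MeasurableSpace Γ] (M : Type v) [MeasurableSpace M]
          (P : LocalDP.Protocol n (Fin n) Γ M),
          P.IsLocallyDP (ε n) (δ n) → ¬ P.Solves (LocalDP.countDistinct n n) (err n)) ∧
    (∃ c : ℝ, 0 < c ∧ ∀ (n : ℕ) (ε : ℝ), 0 ≤ ε → Real.exp (2 * ε) ≤ c * n →
      ∀ (Γ : Type u) [MeasurableSpace Γ] (M : Type v) [MeasurableSpace M]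
        (P : LocalDP.Protocol n (Fin n) Γ M),
        P.IsLocallyDP ε (c / n) → ¬ P.Solves (LocalDP.countDistinct n n) (c * (n / Real.exp ε))) ∧
    (∀ n D : ℕ, 2 ≤ n → 2 ≤ D → LocalDP.IsGlobalSensitivity (LocalDP.countDistinct n D) 1) := by
  refine ⟨fun ε δ err hε hexp hδ herr => ?_, ⟨1 / 4000000000, by norm_num, ?_⟩,
    fun n D hn hD => LocalDP.isGlobalSensitivity_countDistinct hn hD⟩
  · filter_upwards [hexp.def (c := 1 / 4000000000) (by norm_num),
      hδ.def (c := 1 / 16) (by norm_num), herr.def (c := 1 / 20000) (by norm_num),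
      eventually_gt_atTop 0] with n hexp hδ herr hn
    intro Γ _ M _ P hP
    have hn' : (0 : ℝ) < n := by exact_mod_cast hn
    rw [Real.norm_of_nonneg (by positivity), Real.norm_of_nonneg (by positivity)] at hexp
    rw [Real.norm_of_nonneg (by positivity : (0 : ℝ) ≤ 1 / n)] at hδ
    rw [Real.norm_of_nonneg (by positivity : 0 ≤ n / Real.exp (ε n))] at herr
    refine hP.not_solves_countDistinct (hε n) (hexp.trans_eq (by ring)) ?_ ?_
    · calc n * δ n ≤ n * (1 / 16 * (1 / n)) := by
            gcongr
            exact (le_abs_self _).trans hδ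
        _ = 1 / 16 := by field_simp
    · exact (le_abs_self _).trans (herr.trans_eq (by ring))
  · intro n ε hε hexp Γ _ M _ P hP
    refine hP.not_solves_countDistinct hε (hexp.trans_eq (by ring)) ?_ ?_
    · have hn : (n : ℝ) ≠ 0 := fun h => by
        rw [h, mul_zero] at hexp
        exact (Real.exp_pos _).not_ge hexp
      rw [mul_div_cancel₀ _ hn]
      norm_num
    · calc 1 / 4000000000 * (n / Real.exp ε) ≤ 1 / 20000 * (n / Real.exp ε) := by
            gcongr
            norm_num
        _ = n / (20000 * Real.exp ε) := by ring

theorem theorem1 :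
    -- for `ε = O(1)`, no `(ε, o(1/n))`-locally private protocol has error `o(n)`
    (∀ ε δ err : ℕ → ℝ,
      (∀ n, 0 ≤ ε n) →
      (ε =O[atTop] fun _ => (1 : ℝ)) →
      (δ =o[atTop] fun n => 1 / (n : ℝ)) →
      (err =o[atTop] fun n => (n : ℝ)) →
      ∀ᶠ n : ℕ in atTop,
        ∀ (Γ : Type u) [MeasurableSpace Γ] (M : Type v) [MeasurableSpace M]
          (P : LocalDP.Protocol n (Fin n) Γ M),
          P.IsLocallyDP (ε n) (δ n) → ¬ P.Solves (LocalDP.countDistinct n n) (err n)) ∧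
    -- uniformly for `0 ≤ ε ≤ 0.49 ln n`, the error is `Ω(n / e ^ ε)`
    (∃ c : ℝ, 0 < c ∧ ∃ N : ℕ, ∀ n : ℕ, N ≤ n →
      ∀ ε : ℝ, 0 ≤ ε → ε ≤ 0.49 * Real.log n →
        ∀ (Γ : Type u) [MeasurableSpace Γ] (M : Type v) [MeasurableSpace M]
          (P : LocalDP.Protocol n (Fin n) Γ M),
          P.IsLocallyDP ε (c / n) →
            ¬ P.Solves (LocalDP.countDistinct n n) (c * (n / Real.exp ε))) ∧
    -- while the global sensitivity is `1`
    (∀ n : ℕ, 2 ≤ n → LocalDP.IsGlobalSensitivity (LocalDP.countDistinct n n) 1) := by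
  refine ⟨fun ε δ err hε hO hδ herr => theorem1_general.1 ε δ err hε
    (LocalDP.isLittleO_exp_of_tendsto_atTop (hO.const_mul_left 2) tendsto_natCast_atTop_atTop) hδ
    (LocalDP.isLittleO_div_exp hO herr), ?_, fun n hn => theorem1_general.{u, v}.2.2 n n hn hn⟩
  obtain ⟨c, hc, hlower⟩ := theorem1_general.2.1
  obtain ⟨N, hN⟩ := eventually_atTop.1
    (LocalDP.eventually_exp_two_mul_le (by norm_num : (0.49 : ℝ) < 1 / 2) hc)
  exact ⟨c, hc, N, fun n hn ε hε hlog => hlower n ε hε (hN n hn ε hlog)⟩
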